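/- Write $2^{<\omega}$ for the finite and $2^\omega$ for the infinite binary sequences, $\epsilon$ for the empty string, $X{\upharpoonright}m$ for the initial segment of $X$ of length $m$, and $\mu(\sigma)$ for the $\mu$-measure of the set of $X\in 2^\omega$ that extend $\sigma$. Definitions. A (partial) Turing functional $\Phi$ assigns to each $X\in2^\omega$ the finite or infinite sequence $\Phi(X)=\bigcup_m\psi(X{\upharpoonright}m)$, where $\psi:2^{<\omega}\to2^{<\omega}$ is a computable map that is monotone for the prefix order. A map $\phi:2^{<\omega}\to2^{<\omega}$ is the canonical generator of $\Phi$ if, for every $\sigma$, $\phi(\sigma)$ is the longest common initial segment of all $\Phi(X)$ with $X$ extending $\sigma$. In that case put $$\mathrm{OI}_\Phi(X)=\limsup_{m\to\infty}\frac{|\phi(X{\upharpoonright}m)|}{m},\qquad \mathrm{Rate}(\Phi,\mu)=\limsup_{m\to\infty}\sum_{\sigma\in2^m}\mu(\sigma)\frac{|\phi(\sigma)|}{m}.$$ Let $n\ge1$. An $n$-block map is a map $\phi:2^{<\omega}\to2^{<\omega}$ such that $\phi(\sigma_1{}^\frown\cdots{}^\frown\sigma_k{}^\frown\tau)=\phi(\sigma_1)^\frown\cdots{}^\frown\phi(\sigma_k)$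 whenever $k\ge0$, $|\sigma_i|=n$ for all $i$, and $|\tau|<n$; it is non-trivial if $\phi(\sigma)\neq\epsilon$ for some $\sigma$ of length $n$. An $n$-block functional with associated $n$-block map $\phi$ is a Turing functional whose canonical generator is the $n$-block map $\phi$. An $n$-step Bernoulli measure on $2^\omega$ is the image, under concatenation of blocks, of the infinite product of copies of one probability measure on $2^n$. A measure $\mu$ is positive if $\mu(\sigma)>0$ for all $\sigma$, and computable if the reals $\mu(\sigma)$ are computable uniformly in $\sigma$. For computable $\mu$, $X$ is $\mu$-Schnorr random if $X\notin\bigcap_i U_i$ for every sequence $(U_i)_{i\in\omega}$ of uniformly effectively open subsets of $2^\omega$ with $\mu(U_i)\le2^{-i}$ and with $\mu(U_i)$ computable uniformly in $i$. Theorem. Let $n\ge1$, let $\mu$ be a computable, positive $n$-step Bernoulli measure on $2^\omega$, and let $X\in2^\omega$ be $\mu$-Schnorr random. Then for every non-trivial $n$-block map $\phi$ and every $n$-block functional $\Phi$ with associated $n$-block map $\phi$, $$\mathrm{OI}_\Phi(X)=\mathrm{Rate}(\Phi,\mu),$$ and the limit superior that defines $\mathrm{OI}_\Phi(X)$ is a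 limit: $\lim_{m\to\infty}|\phi(X{\upharpoonright}m)|/m=\mathrm{Rate}(\Phi,\mu)$. -/

import Mathlib

open MeasureTheory Filter
open scoped Topology ENNReal

namespace ExtractionRate

/-! ### Strings and sequences -/

/-- Finite binary strings. -/
abbrev Str : Type := List Bool

/-- Infinite binary sequences. -/
abbrev Cantor : Type := ℕ → Bool

/-- The initial segment of `X` of length `m`. -/
def initSeg (X : Cantor) (m : ℕ) : Str := List.ofFn fun i : Fin m => X i

/-- The cylinder of all infinite sequences that extend `σ`. -/
def cyl (σ : Str) : Set Cantor := {X | initSeg X σ.length = σ}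

/-! ### Turing functionals -/

/-- `τ` is an initial segment of the finite or infinite sequence `s`. -/
def IsInitSeg (τ : Str) (s : Stream'.Seq Bool) : Prop :=
  ∀ (i : ℕ) (b : Bool), τ[i]? = some b → s.get? i = some b

/-- `ψ` is a generator of `Φ`: it is monotone for the prefix order, and `Φ X` is the union of the
strings `ψ (initSeg X m)`. The value `Φ X` is a finite or an infinite sequence. -/
def IsGenerator (ψ : Str → Str) (Φ : Cantor → Stream'.Seq Bool) : Prop :=
  (∀ σ τ : Str, σ <+: τ → ψ σ <+: ψ τ) ∧
  ∀ (X : Cantor) (i : ℕ) (b : Bool),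
    (Φ X).get? i = some b ↔ ∃ m : ℕ, (ψ (initSeg X m))[i]? = some b

/-- A (partial) Turing functional is a map that has a computable generator. -/
def IsTuringFunctional (Φ : Cantor → Stream'.Seq Bool) : Prop :=
  ∃ ψ : Str → Str, Computable ψ ∧ IsGenerator ψ Φ

/-- `φ` is the canonical generator of `Φ`: for each `σ`, the string `φ σ` is the longest common
initial segment of all (finite or infinite) sequences `Φ X` with `X` extending `σ`. -/
def IsCanonicalGenerator (φ : Str → Str) (Φ : Cantor → Stream'.Seq Bool) : Prop :=
  ∀ σ : Str, (∀ X ∈ cyl σ, IsInitSeg (φ σ) (Φ X)) ∧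
    ∀ τ : Str, (∀ X ∈ cyl σ, IsInitSeg τ (Φ X)) → τ <+: φ σ

/-- A map has at most one canonical generator. -/
theorem IsCanonicalGenerator.unique {φ ψ : Str → Str} {Φ : Cantor → Stream'.Seq Bool}
    (h₁ : IsCanonicalGenerator φ Φ) (h₂ : IsCanonicalGenerator ψ Φ) : φ = ψ := by
  funext σ
  have h := (h₂ σ).2 _ (h₁ σ).1
  exact h.eq_of_length_le ((h₁ σ).2 _ (h₂ σ).1).length_le

open Classical in
/-- The canonical generator of `Φ` (constantly empty if `Φ` has none, that is, if for some `σ` the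
longest common initial segment is infinite). -/
noncomputable def canonicalGenerator (Φ : Cantor → Stream'.Seq Bool) : Str → Str :=
  if h : ∃ φ : Str → Str, IsCanonicalGenerator φ Φ then h.choose else fun _ => []

theorem IsCanonicalGenerator.canonicalGenerator_eq {φ : Str → Str}
    {Φ : Cantor → Stream'.Seq Bool} (h : IsCanonicalGenerator φ Φ) :
    canonicalGenerator Φ = φ := by
  have hex : ∃ φ : Str → Str, IsCanonicalGenerator φ Φ := ⟨φ, h⟩
  rw [canonicalGenerator, dif_pos hex]
  exact hex.choose_spec.unique h

/-! ### Output/input ratios and extraction rates -/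

/-- The output/input ratio of the string `σ` (only non-empty strings matter below). -/
noncomputable def outIn (φ : Str → Str) (σ : Str) : ℝ≥0∞ :=
  ((φ σ).length : ℝ≥0∞) / (σ.length : ℝ≥0∞)

/-- The `Φ`-extraction rate along `X`. -/
noncomputable def OI (Φ : Cantor → Stream'.Seq Bool) (X : Cantor) : ℝ≥0∞ :=
  limsup (fun m : ℕ => outIn (canonicalGenerator Φ) (initSeg X m)) atTop

/-- The `μ`-average output/input ratio of `φ` over the strings of length `m`. -/
noncomputable def avg (φ : Str → Str) (μ : Measure Cantor) (m : ℕ) : ℝ≥0∞ :=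
  ∑ s : Fin m → Bool, μ (cyl (List.ofFn s)) * outIn φ (List.ofFn s)

/-- The `μ`-extraction rate of `φ`. -/
noncomputable def mapRate (φ : Str → Str) (μ : Measure Cantor) : ℝ≥0∞ :=
  limsup (fun m : ℕ => avg φ μ m) atTop

/-- The `μ`-extraction rate of `Φ`. -/
noncomputable def Rate (Φ : Cantor → Stream'.Seq Bool) (μ : Measure Cantor) : ℝ≥0∞ :=
  mapRate (canonicalGenerator Φ) μ

/-! ### Block maps -/

/-- `φ` is an `n`-block map: it is applied to the successive blocks of length `n`, the outputs are
concatenated, and a last incomplete block is ignored. -/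
def IsBlockMap (n : ℕ) (φ : Str → Str) : Prop :=
  ∀ (blocks : List Str) (τ : Str), (∀ σ ∈ blocks, σ.length = n) → τ.length < n →
    φ (blocks.flatten ++ τ) = (blocks.map φ).flatten

/-- `φ` has a non-empty value on some string of length `n`. -/
def IsNontrivial (n : ℕ) (φ : Str → Str) : Prop :=
  ∃ σ : Str, σ.length = n ∧ 0 < (φ σ).length

/-- `Φ` is an `n`-block functional with associated `n`-block map `φ`: a Turing functional whose
canonical generator is the `n`-block map `φ`. -/
structure IsBlockFunctional (n : ℕ) (φ : Str → Str) (Φ : Cantor → Stream'.Seq Bool) : Prop where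
  isTuringFunctional : IsTuringFunctional Φ
  isBlockMap : IsBlockMap n φ
  isCanonicalGenerator : IsCanonicalGenerator φ Φ

/-! ### Measures -/

/-- A family of non-negative reals is uniformly computable: some computable function gives, for
each index `a` and each `i`, a dyadic rational `p / 2 ^ q` within `2 ^ (-i)` of `r a`. (As
`r a ≥ 0`, restricting to `p ≥ 0` is harmless: a negative approximation can be replaced by `0`.) -/
def UniformlyComputable {α : Type} [Primcodable α] (r : α → ℝ) : Prop :=
  ∃ f : α × ℕ → ℕ × ℕ, Computable f ∧
    ∀ (a : α) (i : ℕ), |r a - ((f (a, i)).1 : ℝ) / 2 ^ (f (a, i)).2| ≤ 1 / 2 ^ i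

/-- The measure `μ` is computable. -/
def IsComputableMeasure (μ : Measure Cantor) : Prop :=
  UniformlyComputable fun σ : Str => (μ (cyl σ)).toReal

/-- The measure `μ` is positive. -/
def IsPositive (μ : Measure Cantor) : Prop := ∀ σ : Str, 0 < μ (cyl σ)

/-- The infinite concatenation of the blocks `B 0`, `B 1`, … of length `n`. -/
def joinBlocks (n : ℕ) [NeZero n] (B : ℕ → (Fin n → Bool)) : Cantor :=
  fun i => B (i / n) (Fin.ofNat n (i % n))

theorem measurable_joinBlocks (n : ℕ) [NeZero n] : Measurable (joinBlocks n) := by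
  unfold joinBlocks
  fun_prop

/-- `μ` is an `n`-step Bernoulli measure: it is the image, under concatenation, of the infinite
product of copies of one probability measure on the set of blocks of length `n`. -/
def IsStepBernoulli (n : ℕ) [NeZero n] (μ : Measure Cantor) : Prop :=
  ∃ ν : Measure (Fin n → Bool), IsProbabilityMeasure ν ∧
    μ = (Measure.infinitePi fun _ : ℕ => ν).map (joinBlocks n)

/-! ### Schnorr randomness -/

/-- The open set generated by the `i`-th section of `W`. -/
def openSection (W : ℕ × Str → Prop) (i : ℕ) : Set Cantor :=
  {X | ∃ σ : Str, W (i, σ) ∧ X ∈ cyl σ}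

/-- `U` is a sequence of uniformly effectively open sets. -/
def UniformlyEffectivelyOpen (U : ℕ → Set Cantor) : Prop :=
  ∃ W : ℕ × Str → Prop, REPred W ∧ ∀ i : ℕ, U i = openSection W i

/-- `U` is a `μ`-Martin-Löf test. -/
def IsMLTest (μ : Measure Cantor) (U : ℕ → Set Cantor) : Prop :=
  UniformlyEffectivelyOpen U ∧ ∀ i : ℕ, μ (U i) ≤ 1 / 2 ^ i

/-- `U` is a `μ`-Schnorr test: a `μ`-Martin-Löf test whose measures are uniformly computable. -/
def IsSchnorrTest (μ : Measure Cantor) (U : ℕ → Set Cantor) : Prop :=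
  IsMLTest μ U ∧ UniformlyComputable fun i : ℕ => (μ (U i)).toReal

/-- `X` is `μ`-Schnorr random: it passes every `μ`-Schnorr test. -/
def IsSchnorrRandom (μ : Measure Cantor) (X : Cantor) : Prop :=
  ∀ U : ℕ → Set Cantor, IsSchnorrTest μ U → X ∉ ⋂ i : ℕ, U i

end ExtractionRate

open ExtractionRate

namespace ExtractionRate

/-! ### Initial segments and cylinders -/

/-! For an `n`-block map, the length of the output on `X↾m` is the sum of the weights `w b = |φ b|`
over the first `⌊m/n⌋` blocks of `X`. Under the measure these blocks are independent with law `ν`,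
so both rates should equal `L / n`, where `L = ∫ w dν`. For the average this is linearity of the
integral (`avg_eq_lintegral`, `lintegral_blockSum`). Along `X` it is a strong law of large numbers,
`tendsto_blockSum_div`.

The point is that Schnorr randomness suffices for that law. By Hoeffding's inequality
(`exists_measureReal_blockSum_gt_le`), the average weight of `k` blocks exceeds a fixed `p > L` with
probability at most `r ^ k`, where `r < 1`. For rational `p` the event is decidable from `n * k`
bits. An effective Borel–Cantelli lemma (`eventually_not`) turns the unions of late events into a
Schnorr test: the geometric bound makes the tails small at a known rate, so the measure of each
union is computable from finite subunions. -/

@[simp] theorem length_initSeg (X : Cantor) (m : ℕ) : (initSeg X m).length = m := by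
  simp [initSeg]

theorem getElem?_initSeg (X : Cantor) {m i : ℕ} (h : i < m) : (initSeg X m)[i]? = some (X i) := by
  simp [initSeg, h]

theorem take_initSeg (X : Cantor) {m k : ℕ} (h : k ≤ m) :
    (initSeg X m).take k = initSeg X k := by
  apply List.ext_getElem?
  intro i
  by_cases hi : i < k
  · rw [List.getElem?_take_of_lt hi, getElem?_initSeg X (hi.trans_le h), getElem?_initSeg X hi]
  · rw [List.getElem?_eq_none (by simp; omega), List.getElem?_eq_none (by simp; omega)]

theorem measurable_initSeg_mem (m : ℕ) (G : Str → Prop) :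
    MeasurableSet {X : Cantor | G (initSeg X m)} := by
  have h : Measurable fun X : Cantor => fun i : Fin m => X i := by fun_prop
  exact h (MeasurableSet.of_discrete (s := {s : Fin m → Bool | G (List.ofFn s)}))

theorem measurableSet_cyl (σ : Str) : MeasurableSet (cyl σ) :=
  measurable_initSeg_mem σ.length (· = σ)

/-- All strings of a given length. -/
def strings : ℕ → List Str
  | 0 => [[]]
  | m + 1 => (strings m).flatMap fun σ => [false :: σ, true :: σ]

theorem mem_strings {m : ℕ} {σ : Str} : σ ∈ strings m ↔ σ.length = m := by
  induction m generalizing σ with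
  | zero => simp [strings]
  | succ m ih =>
    cases σ with
    | nil => simp [strings]
    | cons b σ => cases b <;> simp [strings, ih]

theorem nodup_strings (m : ℕ) : (strings m).Nodup := by
  induction m with
  | zero => simp [strings]
  | succ m ih =>
    rw [strings, List.nodup_flatMap]
    refine ⟨fun σ _ => by simp, ih.imp ?_⟩
    intro σ τ h
    simp [Function.onFun, h.symm]

theorem length_strings (m : ℕ) : (strings m).length = 2 ^ m := by
  induction m with
  | zero => simp [strings]
  | succ m ih => simp [strings, ih, pow_succ, List.length_flatMap]

/-- The measure of a set that is determined by the initial segments of length `m`. -/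
theorem measureReal_initSeg (μ : Measure Cantor) [IsProbabilityMeasure μ] (m : ℕ) (G : Str → Prop)
    [DecidablePred G] :
    μ.real {X | G (initSeg X m)} =
      ((strings m).map fun σ => if G σ then μ.real (cyl σ) else 0).sum := by
  rw [← List.sum_toFinset _ (nodup_strings m), ← Finset.sum_filter]
  rw [← measureReal_biUnion_finset]
  · congr 1
    ext X
    simp only [Set.mem_ofPred_eq, Finset.mem_filter, List.mem_toFinset, mem_strings, Set.mem_iUnion,
      exists_prop, cyl]
    constructor
    · intro h
      exact ⟨_, ⟨length_initSeg X m, h⟩, by simp⟩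
    · rintro ⟨σ, ⟨rfl, h⟩, hX⟩
      rwa [hX]
  · intro σ hσ τ hτ hne
    simp only [Finset.coe_filter, List.mem_toFinset, mem_strings, Set.mem_ofPred_eq] at hσ hτ
    refine Set.disjoint_left.2 fun X h₁ h₂ => hne ?_
    simp only [cyl, Set.mem_ofPred_eq] at h₁ h₂
    rw [← h₁, ← h₂, hσ.1, hτ.1]
  · exact fun σ _ => measurableSet_cyl σ

/-! ### Computability -/

theorem primrec_strings : Primrec strings := by
  have h : Primrec fun m : ℕ => (Nat.rec [[]]
      (fun _ L => L.flatMap fun σ => [false :: σ, true :: σ]) m : List Str) := by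
    refine Primrec.nat_rec₁ _ ?_
    refine Primrec.list_flatMap (Primrec.snd) ?_
    exact Primrec.list_cons.comp (Primrec.list_cons.comp (Primrec.const false) Primrec.snd)
      (Primrec.list_cons.comp (Primrec.list_cons.comp (Primrec.const true) Primrec.snd)
        (Primrec.const []))
  refine h.of_eq fun m => ?_
  induction m with
  | zero => rfl
  | succ m ih => simp only [strings, ← ih]

theorem sum_range_getElem?_elim {β : Type*} (l : List β) (g : β → ℕ) :
    ∑ t ∈ Finset.range l.length, (l[t]?).elim 0 g = (l.map g).sum := by
  induction l with
  | nil => simp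
  | cons b l ih => simp [Finset.sum_range_succ', ih, add_comm]

theorem computable_sum_range {α : Type*} [Primcodable α] {h : α → ℕ} {g : α → ℕ → ℕ}
    (hh : Computable h) (hg : Computable₂ g) :
    Computable fun a => ∑ t ∈ Finset.range (h a), g a t := by
  have := Computable.nat_rec (f := h) (g := fun _ : α => (0 : ℕ))
    (h := fun a p => p.2 + g a p.1) hh (Computable.const 0)
    ((Primrec.nat_add.to_comp).comp (Computable.snd.comp Computable.snd)
      (hg.comp Computable.fst (Computable.fst.comp Computable.snd)))
  refine this.of_eq fun a => ?_
  induction h a with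
  | zero => rfl
  | succ k ih => rw [Finset.sum_range_succ, ← ih]

theorem primrec_sum_range {α : Type*} [Primcodable α] {h : α → ℕ} {g : α → ℕ → ℕ}
    (hh : Primrec h) (hg : Primrec₂ g) :
    Primrec fun a => ∑ t ∈ Finset.range (h a), g a t := by
  have := Primrec.nat_rec' (f := h) (g := fun _ : α => (0 : ℕ))
    (h := fun a p => p.2 + g a p.1) hh (Primrec.const 0)
    ((Primrec.nat_add).comp (Primrec.snd.comp Primrec.snd)
      (hg.comp Primrec.fst (Primrec.fst.comp Primrec.snd)))
  refine this.of_eq fun a => ?_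
  induction h a with
  | zero => rfl
  | succ k ih => rw [Finset.sum_range_succ, ← ih]

theorem computable_list_sum {α β : Type*} [Primcodable α] [Primcodable β] {f : α → List β}
    {g : α → β → ℕ} (hf : Computable f) (hg : Computable₂ g) :
    Computable fun a => ((f a).map (g a)).sum := by
  have : Computable₂ fun (a : α) (t : ℕ) => ((f a)[t]?).elim 0 (g a) := by
    have h := Computable.option_casesOn (o := fun p : α × ℕ => (f p.1)[p.2]?) (f := fun _ => (0 : ℕ))
      (g := fun p b => g p.1 b)
      (Computable.list_getElem?.comp (hf.comp Computable.fst) Computable.snd) (Computable.const 0)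
      (hg.comp (Computable.fst.comp Computable.fst) Computable.snd)
    refine Computable.of_eq h fun p => ?_
    change _ = ((f p.1)[p.2]?).elim 0 (g p.1)
    cases (f p.1)[p.2]? <;> rfl
  refine (computable_sum_range (Computable.list_length.comp hf) this).of_eq fun a => ?_
  exact sum_range_getElem?_elim _ _

theorem primrec_nat_pow : Primrec₂ ((· ^ ·) : ℕ → ℕ → ℕ) :=
  Primrec₂.unpaired'.1 Nat.Primrec.pow

/-- A uniformly computable family has integer approximations with denominator `2 ^ i`. -/
theorem UniformlyComputable.exists_approx {α : Type} [Primcodable α] {r : α → ℝ}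
    (h : UniformlyComputable r) :
    ∃ F : α × ℕ → ℕ, Computable F ∧ ∀ a i, |r a - (F (a, i) : ℝ) / 2 ^ i| ≤ 2 / 2 ^ i := by
  obtain ⟨f, hf, hr⟩ := h
  -- Rounding down to a multiple of `2 ^ (-i)` costs at most another `2 ^ (-i)`, hence the error `2
  -- / 2 ^ i`.
  refine ⟨fun p => (f p).1 * 2 ^ p.2 / 2 ^ (f p).2, ?_, fun a i => ?_⟩
  · have hpow : Computable₂ ((· ^ ·) : ℕ → ℕ → ℕ) := primrec_nat_pow.to_comp
    exact Primrec.nat_div.to_comp.comp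
      (Primrec.nat_mul.to_comp.comp (Computable.fst.comp hf)
        (hpow.comp (Computable.const 2) Computable.snd))
      (hpow.comp (Computable.const 2) (Computable.snd.comp hf))
  · have h₁ := hr a i
    set p := (f (a, i)).1
    set q := (f (a, i)).2
    have hq : (0 : ℝ) < 2 ^ q := by positivity
    have hi : (0 : ℝ) < 2 ^ i := by positivity
    have h₂ : ((p * 2 ^ i / 2 ^ q : ℕ) : ℝ) ≤ p * 2 ^ i / 2 ^ q := by
      simpa using Nat.cast_div_le (α := ℝ) (m := p * 2 ^ i) (n := 2 ^ q)
    have h₃ : (p : ℝ) * 2 ^ i / 2 ^ q < ((p * 2 ^ i / 2 ^ q : ℕ) : ℝ) + 1 := by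
      rw [div_lt_iff₀ hq]
      have := Nat.lt_mul_div_succ (p * 2 ^ i) (b := 2 ^ q) (by positivity)
      rw [mul_comm (2 ^ q)] at this
      exact_mod_cast this
    have h₄ : |(p : ℝ) / 2 ^ q - ((p * 2 ^ i / 2 ^ q : ℕ) : ℝ) / 2 ^ i| ≤ 1 / 2 ^ i := by
      have : (p : ℝ) / 2 ^ q - ((p * 2 ^ i / 2 ^ q : ℕ) : ℝ) / 2 ^ i =
          ((p : ℝ) * 2 ^ i / 2 ^ q - ((p * 2 ^ i / 2 ^ q : ℕ) : ℝ)) / 2 ^ i := by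
        field_simp
      rw [this, abs_div, abs_of_pos hi]
      gcongr
      rw [abs_le]
      constructor <;> linarith
    calc _ ≤ _ := abs_sub_le _ ((p : ℝ) / 2 ^ q) _
      _ ≤ 1 / 2 ^ i + 1 / 2 ^ i := add_le_add h₁ h₄
      _ = 2 / 2 ^ i := by ring

/-- The measures of uniformly decidable clopen sets are uniformly computable. -/
theorem IsComputableMeasure.exists_approx_initSeg {μ : Measure Cantor} [IsProbabilityMeasure μ]
    (hμ : IsComputableMeasure μ) {α : Type} [Primcodable α] {m : α → ℕ} (hm : Computable m)
    {G : α → Str → Prop} [∀ a, DecidablePred (G a)]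
    (hG : Computable₂ fun a σ => decide (G a σ)) :
    ∃ H : α × ℕ → ℕ, Computable H ∧ ∀ a i,
      |μ.real {X | G a (initSeg X (m a))} - (H (a, i) : ℝ) / 2 ^ (m a + i + 1)| ≤ 1 / 2 ^ i := by
  obtain ⟨F, hF, hr⟩ := UniformlyComputable.exists_approx hμ
  refine ⟨fun p => ((strings (m p.1)).map fun σ =>
    if G p.1 σ then F (σ, m p.1 + p.2 + 1) else 0).sum, ?_, fun a i => ?_⟩
  · refine computable_list_sum (primrec_strings.to_comp.comp (hm.comp Computable.fst)) ?_
    have hm' : Computable fun q : (α × ℕ) × Str => m q.1.1 + q.1.2 + 1 :=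
      Computable.succ.comp (Primrec.nat_add.to_comp.comp
        (hm.comp (Computable.fst.comp Computable.fst)) (Computable.snd.comp Computable.fst))
    have := Computable.cond (c := fun q : (α × ℕ) × Str => decide (G q.1.1 q.2))
      (hG.comp (Computable.fst.comp Computable.fst) Computable.snd)
      (hF.comp (Computable.pair Computable.snd hm')) (Computable.const 0)
    refine Computable.of_eq this fun q => ?_
    by_cases h : G q.1.1 q.2 <;> simp [h]
  · rw [measureReal_initSeg]
    -- There are `2 ^ m a` cylinders, each with error at most `2 / 2 ^ d`; this `d` makes the total
    -- exactly `1 / 2 ^ i`.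
    set d := m a + i + 1
    have key : ∀ l : List Str,
        |(l.map fun σ => if G a σ then μ.real (cyl σ) else 0).sum -
          (((l.map fun σ => if G a σ then F (σ, d) else 0).sum : ℕ) : ℝ) / 2 ^ d| ≤
          l.length * (2 / 2 ^ d) := by
      intro l
      induction l with
      | nil => simp
      | cons σ l ih =>
        simp only [List.map_cons, List.sum_cons, Nat.cast_add, List.length_cons, Nat.cast_one]
        rw [add_div, add_sub_add_comm, add_comm (l.length : ℝ), add_mul, one_mul]
        refine (abs_add_le _ _).trans (add_le_add ?_ ih)
        split_ifs
        · exact hr σ d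
        · simp; positivity
    refine (key _).trans (le_of_eq ?_)
    rw [length_strings]
    simp only [d, pow_add]
    push_cast
    field_simp

/-! ### A Borel–Cantelli lemma for Schnorr randomness -/

/-- One of the events `Q k`, `a ≤ k`, is witnessed by the string `σ`, where `Q k` refers to the
initial segment of length `l * k`. -/
def Witnesses (l : ℕ) (Q : ℕ → Str → Prop) (a : ℕ) (σ : Str) : Prop :=
  ∃ k < σ.length + 1, a ≤ k ∧ l * k ≤ σ.length ∧ Q k (σ.take (l * k))

/-- The bound `k < σ.length + 1` in `Witnesses` makes the search for `k` finite. For `0 < l` it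
already follows from `l * k ≤ σ.length`. -/
theorem primrecRel_witnesses (l : ℕ) {Q : ℕ → Str → Prop} (hQ : PrimrecRel Q) :
    PrimrecRel (Witnesses l Q) := by
  have hmul : Primrec fun p : ℕ × (ℕ × Str) => l * p.1 :=
    Primrec.nat_mul.comp (Primrec.const l) Primrec.fst
  have hstr : Primrec fun p : ℕ × (ℕ × Str) => p.2.2 := Primrec.snd.comp Primrec.snd
  have h : PrimrecRel fun (k : ℕ) (p : ℕ × Str) =>
      p.1 ≤ k ∧ l * k ≤ p.2.length ∧ Q k (p.2.take (l * k)) := by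
    refine PrimrecPred.and ?_ (PrimrecPred.and ?_ ?_)
    · exact Primrec.nat_le.comp (Primrec.fst.comp Primrec.snd) Primrec.fst
    · exact Primrec.nat_le.comp hmul (Primrec.list_length.comp hstr)
    · exact hQ.comp Primrec.fst (Primrec.list_take.comp hmul hstr)
  have hlen : Primrec fun p : ℕ × Str => List.range (p.2.length + 1) :=
    Primrec.list_range.comp (Primrec.succ.comp (Primrec.list_length.comp Primrec.snd))
  refine (PrimrecRel.comp (PrimrecRel.exists_mem_list h) hlen Primrec.id).of_eq fun p => ?_
  simp [Witnesses]

/-- This makes the union of the events from `a` to `M` a clopen set decided at the single length `l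
* M`, so that its measure can be approximated. -/
theorem witnesses_initSeg {l : ℕ} (hl : 0 < l) {Q : ℕ → Str → Prop} {a M : ℕ} {X : Cantor} :
    Witnesses l Q a (initSeg X (l * M)) ↔ ∃ k, a ≤ k ∧ k ≤ M ∧ Q k (initSeg X (l * k)) := by
  simp only [Witnesses, length_initSeg]
  constructor
  · rintro ⟨k, -, hak, hk, hQ⟩
    rw [take_initSeg X hk] at hQ
    exact ⟨k, hak, Nat.le_of_mul_le_mul_left hk hl, hQ⟩
  · rintro ⟨k, hak, hkM, hQ⟩
    have hk : l * k ≤ l * M := Nat.mul_le_mul_left l hkM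
    refine ⟨k, ?_, hak, hk, by rwa [take_initSeg X hk]⟩
    nlinarith

theorem exists_witnesses_cyl {l : ℕ} (hl : 0 < l) {Q : ℕ → Str → Prop} {a : ℕ} {X : Cantor} :
    (∃ σ, Witnesses l Q a σ ∧ X ∈ cyl σ) ↔ ∃ k, a ≤ k ∧ Q k (initSeg X (l * k)) := by
  constructor
  · rintro ⟨σ, ⟨k, -, hak, hk, hQ⟩, hX⟩
    rw [← (show initSeg X σ.length = σ from hX), take_initSeg X hk] at hQ
    exact ⟨k, hak, hQ⟩
  · rintro ⟨k, hak, hQ⟩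
    exact ⟨initSeg X (l * k), (witnesses_initSeg hl).2 ⟨k, hak, le_rfl, hQ⟩, by simp [cyl]⟩

theorem measureReal_exists_ge_le (μ : Measure Cantor) [IsProbabilityMeasure μ]
    {A : ℕ → Set Cantor} {r : ℝ} (hr₀ : 0 ≤ r) (hr₁ : r < 1)
    (hA : ∀ k, μ.real (A k) ≤ r ^ k) (a : ℕ) :
    μ.real {X | ∃ k, a ≤ k ∧ X ∈ A k} ≤ r ^ a / (1 - r) := by
  have hsum : HasSum (fun j : ℕ => r ^ (a + j)) (r ^ a / (1 - r)) := by
    simpa [pow_add, div_eq_mul_inv] using (hasSum_geometric_of_lt_one hr₀ hr₁).mul_left (r ^ a)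
  refine ENNReal.toReal_le_of_le_ofReal (by have : 0 < 1 - r := by linarith
                                            positivity) ?_
  calc μ {X | ∃ k, a ≤ k ∧ X ∈ A k} ≤ μ (⋃ j, A (a + j)) := by
        refine measure_mono ?_
        rintro X ⟨k, hak, hX⟩
        exact Set.mem_iUnion.2 ⟨k - a, by rwa [Nat.add_sub_cancel' hak]⟩
    _ ≤ ∑' j, μ (A (a + j)) := measure_iUnion_le _
    _ ≤ ∑' j, ENNReal.ofReal (r ^ (a + j)) := by
        refine ENNReal.tsum_le_tsum fun j => ?_
        rw [← ofReal_measureReal]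
        exact ENNReal.ofReal_le_ofReal (hA _)
    _ = ENNReal.ofReal (r ^ a / (1 - r)) := by
        rw [← ENNReal.ofReal_tsum_of_nonneg (fun j => by positivity) hsum.summable, hsum.tsum_eq]

/-- If the `k`-th event is primitive recursive in the initial segment of length `l * k` and has
measure at most `r ^ k` with `r < 1`, then a Schnorr random sequence lies in finitely many of the
events. -/
theorem IsSchnorrRandom.eventually_not {μ : Measure Cantor} [IsProbabilityMeasure μ]
    (hμ : IsComputableMeasure μ) {X : Cantor} (hX : IsSchnorrRandom μ X) {l : ℕ} (hl : 0 < l)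
    {Q : ℕ → Str → Prop} (hQ : PrimrecRel Q) {r : ℝ} (hr₀ : 0 ≤ r) (hr₁ : r < 1)
    (hbound : ∀ k, μ.real {Y | Q k (initSeg Y (l * k))} ≤ r ^ k) :
    ∀ᶠ k in atTop, ¬ Q k (initSeg X (l * k)) := by
  classical
  -- With `T i = N * (i + 1)`, the factor `(r ^ N) ^ i` gives `2 ^ (-i)`, and the spare factor `r ^
  -- N` absorbs `1 / (1 - r)`.
  obtain ⟨N, hN₁, hN₂⟩ : ∃ N : ℕ, r ^ N ≤ 1 / 2 ∧ r ^ N / (1 - r) ≤ 1 := by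
    have h := tendsto_pow_atTop_nhds_zero_of_lt_one hr₀ hr₁
    have h' := h.div_const (1 - r)
    rw [zero_div] at h'
    exact ((h.eventually_le_const (by norm_num)).and (h'.eventually_le_const one_pos)).exists
  set T : ℕ → ℕ := fun i => N * (i + 1) with hT
  have htail : ∀ i, μ.real {Y | ∃ k, T i ≤ k ∧ Y ∈ {Y | Q k (initSeg Y (l * k))}} ≤ 1 / 2 ^ i := by
    intro i
    refine (measureReal_exists_ge_le μ hr₀ hr₁ hbound _).trans ?_
    calc r ^ T i / (1 - r) = (r ^ N) ^ i * (r ^ N / (1 - r)) := by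
          simp only [hT]
          rw [mul_add, pow_add, pow_mul, mul_one]; ring
      _ ≤ (1 / 2) ^ i * 1 := by
          have : 0 < 1 - r := by linarith
          gcongr
      _ = 1 / 2 ^ i := by rw [mul_one, one_div_pow]
  have hTp : Primrec T := Primrec.nat_mul.comp (Primrec.const N) Primrec.succ
  set U : ℕ → Set Cantor := fun i => {Y | ∃ k, T i ≤ k ∧ Y ∈ {Y | Q k (initSeg Y (l * k))}} with hU
  have hW := primrecRel_witnesses l hQ
  have hopen : UniformlyEffectivelyOpen U := by
    refine ⟨fun p => Witnesses l Q (T p.1) p.2, ?_, fun i => ?_⟩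
    · have : PrimrecPred fun p : ℕ × Str => Witnesses l Q (T p.1) p.2 :=
        hW.comp (hTp.comp Primrec.fst) Primrec.snd
      obtain ⟨hd, hp⟩ := this
      exact ComputablePred.to_re ⟨hd, hp.to_comp⟩
    · ext Y
      exact (exists_witnesses_cyl hl).symm
  have hcomp : UniformlyComputable fun i => (μ (U i)).toReal := by
    have hm : Primrec fun p : ℕ × ℕ => l * T p.2 :=
      Primrec.nat_mul.comp (Primrec.const l) (hTp.comp Primrec.snd)
    have hG : PrimrecRel fun (p : ℕ × ℕ) (σ : Str) => Witnesses l Q (T p.1) σ :=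
      hW.comp (hTp.comp (Primrec.fst.comp Primrec.fst)) Primrec.snd
    obtain ⟨H, hH, hHr⟩ := hμ.exists_approx_initSeg hm.to_comp
      (G := fun (p : ℕ × ℕ) (σ : Str) => Witnesses l Q (T p.1) σ) hG.decide.to_comp
    have hs : Primrec fun p : ℕ × ℕ => (p.1, p.2 + 1) :=
      Primrec.pair Primrec.fst (Primrec.succ.comp Primrec.snd)
    have hs₂ : Primrec fun p : ℕ × ℕ => p.2 + 1 := Primrec.succ.comp Primrec.snd
    -- To approximate `μ (U i)` within `2 ^ (-j)`, keep only the events up to `T (j + 1)`. The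
    -- discarded part lies in `U (j + 1)`, so truncation and the approximation of the clopen part
    -- each cost at most `2 ^ (-(j + 1))`.
    refine ⟨fun p => (H ((p.1, p.2 + 1), p.2 + 1), l * T (p.2 + 1) + (p.2 + 1) + 1), ?_,
      fun i j => ?_⟩
    · exact Computable.pair (hH.comp (Primrec.pair hs hs₂).to_comp)
        (Primrec.succ.comp (Primrec.nat_add.comp (hm.comp hs) hs₂)).to_comp
    · have h₁ := hHr (i, j + 1) (j + 1)
      simp only [witnesses_initSeg hl] at h₁
      set V : Set Cantor := {Y | ∃ k, T i ≤ k ∧ k ≤ T (j + 1) ∧ Q k (initSeg Y (l * k))} with hV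
      have hVU : V ⊆ U i := fun Y ⟨k, h, _, h'⟩ => ⟨k, h, h'⟩
      have hUV : U i ⊆ V ∪ U (j + 1) := by
        rintro Y ⟨k, h, h'⟩
        rcases le_total k (T (j + 1)) with hk | hk
        · exact Or.inl ⟨k, h, hk, h'⟩
        · exact Or.inr ⟨k, hk, h'⟩
      have h₂ : μ.real V ≤ μ.real (U i) := measureReal_mono hVU
      have h₃ : μ.real (U i) ≤ μ.real V + 1 / 2 ^ (j + 1) :=
        (measureReal_mono hUV).trans ((measureReal_union_le _ _).trans
          (by gcongr; exact htail (j + 1)))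
      have h₄ : |μ.real (U i) - μ.real V| ≤ 1 / 2 ^ (j + 1) := by
        rw [abs_le]
        constructor <;> linarith [show (0 : ℝ) ≤ 1 / 2 ^ (j + 1) by positivity]
      calc _ ≤ _ := abs_sub_le _ (μ.real V) _
        _ ≤ 1 / 2 ^ (j + 1) + 1 / 2 ^ (j + 1) := add_le_add h₄ h₁
        _ = 1 / 2 ^ j := by rw [pow_succ]; field_simp; norm_num
  have htest : IsSchnorrTest μ U := by
    refine ⟨⟨hopen, fun i => ?_⟩, hcomp⟩
    rw [← ofReal_measureReal]
    refine (ENNReal.ofReal_le_ofReal (htail i)).trans (le_of_eq ?_)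
    rw [ENNReal.ofReal_div_of_pos (by positivity), ENNReal.ofReal_pow (by norm_num)]
    simp
  have hnot := hX U htest
  simp only [Set.mem_iInter, not_forall] at hnot
  obtain ⟨i, hi⟩ := hnot
  filter_upwards [eventually_ge_atTop (T i)] with k hk hQk
  exact hi ⟨k, hk, hQk⟩

/-! ### The law of large numbers for block weights -/

section Blocks

variable {n : ℕ}

/-- The `j`-th block of length `n` of a sequence. -/
def block (n : ℕ) (X : Cantor) (j : ℕ) : Fin n → Bool := fun i => X (n * j + i)

/-- The `j`-th block of length `n` of a string. -/
def strBlock (n : ℕ) (σ : Str) (j : ℕ) : Fin n → Bool := fun i => σ.getD (n * j + i) false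

theorem block_joinBlocks [NeZero n] (B : ℕ → Fin n → Bool) (j : ℕ) :
    block n (joinBlocks n B) j = B j := by
  funext i
  have hi : (n * j + i) / n = j := by
    rw [Nat.mul_add_div (NeZero.pos n), Nat.div_eq_of_lt i.2, add_zero]
  have hi' : Fin.ofNat n ((n * j + i) % n) = i := by
    ext
    simp [Nat.mod_eq_of_lt i.2]
  rw [block, joinBlocks, hi, hi']

theorem strBlock_initSeg (X : Cantor) {j k : ℕ} (h : j < k) :
    strBlock n (initSeg X (n * k)) j = block n X j := by
  funext i
  have hi : n * j + i < n * k :=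
    calc n * j + i < n * j + n := by omega
      _ = n * (j + 1) := by ring
      _ ≤ n * k := Nat.mul_le_mul_left n h
  rw [strBlock, List.getD_eq_getElem?_getD, getElem?_initSeg X hi]
  rfl

theorem primrec_strBlock : Primrec₂ (strBlock n) := by
  refine Primrec.fin_curry.2 ?_
  refine (Primrec.list_getD false).comp (Primrec.fst.comp Primrec.fst) ?_
  exact Primrec.nat_add.comp (Primrec.nat_mul.comp (Primrec.const n) (Primrec.snd.comp Primrec.fst))
    (Primrec.fin_val.comp Primrec.snd)

/-- The total weight of the first `k` blocks. -/
def blockSum (w : (Fin n → Bool) → ℕ) (X : Cantor) (k : ℕ) : ℕ :=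
  ∑ j ∈ Finset.range k, w (block n X j)

theorem sum_strBlock_initSeg (w : (Fin n → Bool) → ℕ) (X : Cantor) (k : ℕ) :
    ∑ j ∈ Finset.range k, w (strBlock n (initSeg X (n * k)) j) = blockSum w X k :=
  Finset.sum_congr rfl fun j hj => by rw [strBlock_initSeg X (Finset.mem_range.1 hj)]

theorem primrecRel_lt_sum_strBlock (w : (Fin n → Bool) → ℕ) (a d : ℕ) :
    PrimrecRel fun (k : ℕ) (σ : Str) =>
      a * k < d * ∑ j ∈ Finset.range k, w (strBlock n σ j) := by
  have hw : Primrec w := Primrec.dom_finite w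
  have hsum : Primrec fun p : ℕ × Str => ∑ j ∈ Finset.range p.1, w (strBlock n p.2 j) :=
    primrec_sum_range (g := fun (p : ℕ × Str) j => w (strBlock n p.2 j)) Primrec.fst
      (hw.comp (primrec_strBlock.comp (Primrec.snd.comp Primrec.fst) Primrec.snd))
  exact Primrec.nat_lt.comp (Primrec.nat_mul.comp (Primrec.const a) Primrec.fst)
    (Primrec.nat_mul.comp (Primrec.const d) hsum)

open ProbabilityTheory in
/-- Hoeffding's inequality for the block weights. -/
theorem exists_measureReal_blockSum_gt_le [NeZero n] (ν : Measure (Fin n → Bool))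
    [IsProbabilityMeasure ν] (w : (Fin n → Bool) → ℕ) {p : ℝ} (hp : ∫ b, (w b : ℝ) ∂ν < p) :
    ∃ r : ℝ, 0 ≤ r ∧ r < 1 ∧ ∀ k : ℕ,
      ((Measure.infinitePi fun _ : ℕ => ν).map (joinBlocks n)).real
        {Y | p * k < blockSum w Y k} ≤ r ^ k := by
  set P := Measure.infinitePi fun _ : ℕ => ν
  set L := ∫ b, (w b : ℝ) ∂ν
  obtain ⟨C, hC⟩ : ∃ C : ℕ, ∀ b, w b ≤ C :=
    ⟨_, fun b => Finset.le_sup (f := w) (Finset.mem_univ b)⟩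
  have hwm : Measurable fun b => (w b : ℝ) := measurable_of_finite _
  -- The interval `[0, C + 1]` instead of `[0, C]` keeps the sub-Gaussian parameter positive even
  -- when all weights vanish.
  set c : NNReal := (‖(C + 1 : ℝ) - 0‖₊ / 2) ^ 2 with hc
  have hc₀ : (0 : ℝ) < c := by
    have : (0 : ℝ) < C + 1 := by positivity
    have : ((C : ℝ) + 1 - 0) ≠ 0 := by rw [sub_zero]; exact this.ne'
    have : 0 < ‖(C + 1 : ℝ) - 0‖₊ := nnnorm_pos.2 this
    exact_mod_cast (by positivity : 0 < c)
  have hsub : HasSubgaussianMGF (fun b => (w b : ℝ) - L) c ν := by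
    refine hasSubgaussianMGF_of_mem_Icc hwm.aemeasurable (ae_of_all _ fun b => ⟨by positivity, ?_⟩)
    have : (w b : ℝ) ≤ C := by exact_mod_cast hC b
    linarith
  have hindep : iIndepFun (fun (j : ℕ) (B : ℕ → Fin n → Bool) => (w (B j) : ℝ) - L) P :=
    iIndepFun_infinitePi (X := fun _ b => (w b : ℝ) - L) fun _ => hwm.sub_const L
  have hsub' : ∀ j, HasSubgaussianMGF (fun B : ℕ → Fin n → Bool => (w (B j) : ℝ) - L) c P := by
    intro j
    have h := Measure.infinitePi_map_eval (fun _ : ℕ => ν) j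
    rw [← h] at hsub
    exact HasSubgaussianMGF.of_map (Y := fun B : ℕ → Fin n → Bool => B j)
      (measurable_pi_apply j).aemeasurable hsub
  have hq : 0 < (p - L) ^ 2 / (2 * c) := by
    have : 0 < p - L := by linarith
    positivity
  refine ⟨Real.exp (-((p - L) ^ 2 / (2 * c))), (Real.exp_pos _).le,
    Real.exp_lt_one_iff.2 (by linarith), fun k => ?_⟩
  have hmeas : MeasurableSet {Y : Cantor | p * k < blockSum w Y k} := by
    have := measurable_initSeg_mem (n * k)
      fun σ => p * k < (∑ j ∈ Finset.range k, w (strBlock n σ j) : ℕ)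
    simpa only [sum_strBlock_initSeg] using this
  rw [map_measureReal_apply (measurable_joinBlocks n) hmeas]
  have hε : 0 ≤ k * (p - L) := mul_nonneg (by positivity) (by linarith)
  refine (measureReal_mono ?_).trans
    ((HasSubgaussianMGF.measure_sum_range_ge_le_of_iIndepFun hindep (n := k)
      (fun j _ => hsub' j) hε).trans (le_of_eq ?_))
  · intro B hB
    simp only [Set.mem_preimage, Set.mem_ofPred_eq, blockSum, block_joinBlocks] at hB ⊢
    push_cast at hB
    rw [Finset.sum_sub_distrib]
    simp only [Finset.sum_const, Finset.card_range, nsmul_eq_mul]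
    linarith
  -- Hoeffding's exponent at deviation `k * (p - L)` is linear in `k`. For `k = 0` it involves a
  -- division by zero, and both sides are `1`.
  · rw [← Real.exp_nat_mul]
    congr 1
    rcases Nat.eq_zero_or_pos k with rfl | hk
    · simp
    · have : (0 : ℝ) < k := by exact_mod_cast hk
      field_simp

variable [NeZero n] {ν : Measure (Fin n → Bool)} [IsProbabilityMeasure ν] {X : Cantor}

theorem IsSchnorrRandom.eventually_blockSum_div_lt
    (hμ : IsComputableMeasure ((Measure.infinitePi fun _ : ℕ => ν).map (joinBlocks n)))
    (hX : IsSchnorrRandom ((Measure.infinitePi fun _ : ℕ => ν).map (joinBlocks n)) X)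
    (w : (Fin n → Bool) → ℕ) {y : ℝ} (hy : ∫ b, (w b : ℝ) ∂ν < y) :
    ∀ᶠ k : ℕ in atTop, (blockSum w X k : ℝ) / k < y := by
  -- A rational threshold turns the deviation event into an inequality between natural numbers,
  -- hence a primitive recursive one.
  obtain ⟨q, hq₁, hq₂⟩ := exists_rat_btwn hy
  have hq₀ : 0 ≤ q := by
    have : (0 : ℝ) ≤ ∫ b, (w b : ℝ) ∂ν := integral_nonneg fun b => by positivity
    exact_mod_cast (this.trans hq₁.le)
  lift q to ℚ≥0 using hq₀
  have hqd : (((q : ℚ≥0) : ℚ) : ℝ) = (q.num : ℝ) / q.den := by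
    rw [← NNRat.cast_def]; simp
  have hd : (0 : ℝ) < q.den := by exact_mod_cast q.den_pos
  obtain ⟨r, hr₀, hr₁, hr⟩ := exists_measureReal_blockSum_gt_le ν w hq₁
  have hiff : ∀ (Y : Cantor) (k : ℕ),
      q.num * k < q.den * ∑ j ∈ Finset.range k, w (strBlock n (initSeg Y (n * k)) j) ↔
        (((q : ℚ≥0) : ℚ) : ℝ) * k < blockSum w Y k := by
    intro Y k
    rw [sum_strBlock_initSeg, hqd, div_mul_eq_mul_div, div_lt_iff₀ hd, mul_comm (blockSum w Y k : ℝ)]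
    exact_mod_cast Iff.rfl
  have := Measure.isProbabilityMeasure_map (μ := Measure.infinitePi fun _ : ℕ => ν)
    (measurable_joinBlocks n).aemeasurable
  have hev := hX.eventually_not hμ (NeZero.pos n) (primrecRel_lt_sum_strBlock w q.num q.den)
    hr₀ hr₁ (by simpa only [hiff] using hr)
  filter_upwards [hev, eventually_gt_atTop 0] with k hk hk₀
  rw [hiff, not_lt] at hk
  have : (0 : ℝ) < k := by exact_mod_cast hk₀
  exact ((div_le_iff₀ this).2 hk).trans_lt hq₂

/-- The lower estimate is the upper estimate for the complementary weights `C - w`, where `C` bounds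
`w`. -/
theorem IsSchnorrRandom.tendsto_blockSum_div
    (hμ : IsComputableMeasure ((Measure.infinitePi fun _ : ℕ => ν).map (joinBlocks n)))
    (hX : IsSchnorrRandom ((Measure.infinitePi fun _ : ℕ => ν).map (joinBlocks n)) X)
    (w : (Fin n → Bool) → ℕ) :
    Tendsto (fun k : ℕ => (blockSum w X k : ℝ) / k) atTop (𝓝 (∫ b, (w b : ℝ) ∂ν)) := by
  obtain ⟨C, hC⟩ : ∃ C : ℕ, ∀ b, w b ≤ C :=
    ⟨_, fun b => Finset.le_sup (f := w) (Finset.mem_univ b)⟩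
  refine tendsto_order.2 ⟨fun y hy => ?_, fun y hy => hX.eventually_blockSum_div_lt hμ w hy⟩
  have hint : ∫ b, ((C - w b : ℕ) : ℝ) ∂ν = C - ∫ b, (w b : ℝ) ∂ν := by
    simp only [Nat.cast_sub (hC _)]
    rw [integral_sub (integrable_const _) Integrable.of_finite]
    simp
  have h := hX.eventually_blockSum_div_lt hμ (fun b => C - w b) (y := C - y)
    (by rw [hint]; linarith)
  filter_upwards [h, eventually_gt_atTop 0] with k hk hk₀
  have hk₀ : (0 : ℝ) < k := by exact_mod_cast hk₀
  have : (blockSum (fun b => C - w b) X k : ℝ) = k * C - blockSum w X k := by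
    simp [blockSum, Nat.cast_sub (hC _), Finset.sum_sub_distrib]
  rw [this, sub_div, mul_div_cancel_left₀ _ hk₀.ne'] at hk
  linarith

end Blocks

/-! ### Block maps -/

theorem initSeg_add (X : Cantor) (a b : ℕ) :
    initSeg X (a + b) = initSeg X a ++ List.ofFn fun i : Fin b => X (a + i) := by
  apply List.ext_getElem
  · simp
  · intro i h₁ h₂
    rw [List.getElem_append]
    split_ifs with h
    · simp [initSeg]
    · simp only [length_initSeg, not_lt] at h
      simp [initSeg, Nat.add_sub_cancel' h]

theorem initSeg_mul (n : ℕ) (X : Cantor) (k : ℕ) :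
    initSeg X (n * k) = ((List.range k).map fun j => List.ofFn (block n X j)).flatten := by
  induction k with
  | zero => simp [initSeg]
  | succ k ih =>
    rw [mul_add, mul_one, initSeg_add, ih, List.range_succ]
    simp
    rfl

theorem IsBlockMap.length_initSeg {n : ℕ} (hn : 0 < n) {φ : Str → Str} (hφ : IsBlockMap n φ)
    (X : Cantor) (m : ℕ) :
    (φ (initSeg X m)).length = blockSum (fun b : Fin n → Bool => (φ (List.ofFn b)).length) X
      (m / n) := by
  conv_lhs => rw [← Nat.div_add_mod m n, initSeg_add, initSeg_mul]
  rw [hφ _ _ (by simp) (by simpa using Nat.mod_lt m hn), List.map_map, List.length_flatten,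
    List.map_map]
  rfl

/-! ### Average rates as expectations, and the limit of `⌊m/n⌋ / m` -/

theorem avg_eq_lintegral (φ : Str → Str) (μ : Measure Cantor) (m : ℕ) :
    avg φ μ m = ∫⁻ Y, outIn φ (initSeg Y m) ∂μ := by
  have hm : Measurable fun (Y : Cantor) (i : Fin m) => Y i := by fun_prop
  have h := lintegral_map (μ := μ)
    (measurable_of_finite fun s : Fin m → Bool => outIn φ (List.ofFn s)) hm
  rw [lintegral_fintype] at h
  rw [avg]
  refine Eq.trans (Finset.sum_congr rfl fun s _ => ?_) h
  rw [Measure.map_apply hm (measurableSet_singleton s), mul_comm]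
  congr 2
  ext Y
  simp only [cyl, initSeg, Set.mem_ofPred_eq, Set.mem_preimage, Set.mem_singleton_iff]
  constructor
  · intro h
    funext i
    have := congrArg (fun l : Str => l[(i : ℕ)]?) h
    simpa using this
  · rintro rfl
    simp

/-- Only linearity and the law `ν` of each single block enter; independence plays no role. -/
theorem lintegral_blockSum {n : ℕ} [NeZero n] (ν : Measure (Fin n → Bool)) [IsProbabilityMeasure ν]
    (w : (Fin n → Bool) → ℕ) (k : ℕ) :
    ∫⁻ Y, (blockSum w Y k : ℝ≥0∞) ∂(Measure.infinitePi fun _ : ℕ => ν).map (joinBlocks n) =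
      k * ∫⁻ b, (w b : ℝ≥0∞) ∂ν := by
  have hw : Measurable fun b => (w b : ℝ≥0∞) := measurable_of_finite _
  have hb : ∀ j, Measurable fun Y : Cantor => (w (block n Y j) : ℝ≥0∞) := fun j =>
    hw.comp (by unfold block; fun_prop)
  simp only [blockSum, Nat.cast_sum]
  rw [lintegral_finsetSum _ fun j _ => hb j]
  have h : ∀ j, ∫⁻ Y, (w (block n Y j) : ℝ≥0∞)
      ∂(Measure.infinitePi fun _ : ℕ => ν).map (joinBlocks n) = ∫⁻ b, (w b : ℝ≥0∞) ∂ν := by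
    intro j
    rw [lintegral_map (hb j) (measurable_joinBlocks n)]
    simp only [block_joinBlocks]
    exact (measurePreserving_eval_infinitePi (fun _ : ℕ => ν) j).lintegral_comp hw
  simp [h]

theorem tendsto_natDiv_div (n : ℕ) :
    Tendsto (fun m : ℕ => ((m / n : ℕ) : ℝ) / m) atTop (𝓝 (1 / n)) := by
  have h := (tendsto_nat_floor_mul_div_atTop (R := ℝ) (a := 1 / n) (by positivity)).comp
    tendsto_natCast_atTop_atTop
  refine h.congr fun m => ?_
  simp only [Function.comp_apply, one_div_mul_eq_div, Nat.floor_div_eq_div]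

theorem natCast_div_eq_ofReal {a m : ℕ} (hm : 0 < m) :
    (a : ℝ≥0∞) / m = ENNReal.ofReal (a / m) := by
  rw [ENNReal.ofReal_div_of_pos (by exact_mod_cast hm)]
  simp

end ExtractionRate

open ExtractionRate

theorem mainTheorem3 (n : ℕ) [NeZero n] (μ : Measure Cantor)
    (hBernoulli : IsStepBernoulli n μ) (hcomputable : IsComputableMeasure μ)
    (hpositive : IsPositive μ) (X : Cantor) (hX : IsSchnorrRandom μ X)
    (φ : Str → Str) (Φ : Cantor → Stream'.Seq Bool)
    (hΦ : IsBlockFunctional n φ Φ) (hφ : IsNontrivial n φ) :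
    OI Φ X = Rate Φ μ ∧
      Tendsto (fun m : ℕ => outIn (canonicalGenerator Φ) (initSeg X m)) atTop
        (𝓝 (Rate Φ μ)) := by
  obtain ⟨ν, hν, rfl⟩ := hBernoulli
  have hn : 0 < n := NeZero.pos n
  have hblock := hΦ.isBlockMap
  rw [OI, Rate, mapRate, hΦ.isCanonicalGenerator.canonicalGenerator_eq]
  set w : (Fin n → Bool) → ℕ := fun b => (φ (List.ofFn b)).length
  set L : ℝ := ∫ b, (w b : ℝ) ∂ν
  have hL : ∫⁻ b, (w b : ℝ≥0∞) ∂ν = ENNReal.ofReal L := by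
    rw [ofReal_integral_eq_lintegral_ofReal Integrable.of_finite
      (ae_of_all _ fun b => by positivity)]
    simp
  have hout : ∀ (Y : Cantor) (m : ℕ),
      outIn φ (initSeg Y m) = (blockSum w Y (m / n) : ℝ≥0∞) / m := by
    intro Y m
    rw [outIn, hblock.length_initSeg hn, length_initSeg]
  have hOI : Tendsto (fun m : ℕ => outIn φ (initSeg X m)) atTop (𝓝 (ENNReal.ofReal (L * (1 / n)))) := by
    have h := ((hX.tendsto_blockSum_div hcomputable w).comp
      (Nat.tendsto_div_const_atTop hn.ne')).mul (tendsto_natDiv_div n)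
    refine (ENNReal.tendsto_ofReal h).congr' ?_
    -- The ratio factors as (weight sum / `⌊m/n⌋`) times (`⌊m/n⌋ / m`); `m ≥ n` makes the cancelled
    -- factor nonzero.
    filter_upwards [eventually_ge_atTop n] with m hm
    have hk : ((m / n : ℕ) : ℝ) ≠ 0 := by exact_mod_cast (Nat.div_pos hm hn).ne'
    rw [hout, natCast_div_eq_ofReal (hn.trans_le hm), Function.comp_apply, div_mul_div_cancel₀ hk]
  have havg : Tendsto (fun m : ℕ => avg φ ((Measure.infinitePi fun _ : ℕ => ν).map (joinBlocks n)) m)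
      atTop (𝓝 (ENNReal.ofReal (L * (1 / n)))) := by
    -- For `m > 0` the average is exactly `L * (⌊m/n⌋ / m)`.
    refine (ENNReal.tendsto_ofReal ((tendsto_natDiv_div n).const_mul L)).congr' ?_
    filter_upwards [eventually_gt_atTop 0] with m hm
    rw [avg_eq_lintegral]
    simp only [hout, div_eq_mul_inv]
    rw [lintegral_mul_const' _ _ (by simpa using hm.ne'), lintegral_blockSum, hL,
      ENNReal.ofReal_mul' (by positivity), ← div_eq_mul_inv, ← natCast_div_eq_ofReal hm,
      div_eq_mul_inv]
    ring
  rw [havg.limsup_eq]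
  exact ⟨hOI.limsup_eq, hOI⟩
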